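/- **Data model.** Let $\mu_1,\mu_2\in\mathbb R^D$, $\rho=\|\mu_1-\mu_2\|_2$, $\sigma>0$, and let $K=2$ be the number of classes. A graph $G$ on $n$ nodes and node features $X\in\mathbb R^{n\times D}$ are given, with mean-aggregated features $g_i=g_i(X,G)=|\mathcal N(i)|^{-1}\sum_{j\in\mathcal N(i)}X_j$. Node subgroups $V_0$ (the training nodes, $N_0=|V_0|$), $V_1,\dots,V_M$ follow a generalized CSBM-S model: subgroup $V_i$ has intra- and inter-class edge probabilities $p_i,q_i\in[0,1]$, $p_i+q_i>0$, with $p_i+q_i$ the same for all $i$, and homophily ratio $h_i=p_i/(p_i+q_i)$. The two classes are balanced, and the aggregated feature of a node of $V_i$ has law $N\big(\tfrac{p_i\mu_1+q_i\mu_2}{p_i+q_i},\sigma^2I\big)$ in class 1 and $N\big(\tfrac{q_i\mu_1+p_i\mu_2}{p_i+q_i},\sigma^2I\big)$ in class 2. Given $(X,G)$, labels are independent, $y_j\sim\Pr(y\mid g_j)$, where $\Pr(y\mid g_j)$ is the posterior given by Bayes' rule for the subgroup of $j$. **Classifiers.** $\mathcal H$ consists of $h_j=f(g_j;W_1,\dots,W_L)\in\mathbb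 R^K$, where $f$ is an $L$-layer MLP ($L\ge1$, no biases) with ReLU on the hidden layers, fixed layer widths and $\|W_l\|_F\le C$ for all $l$; $b\ge1$ is the largest width of the hidden layers (or any upper bound of these widths). For a margin $\gamma$ the empirical loss on $V_i$ is $\widehat{\mathcal L}^\gamma_i(h)=\frac1{|V_i|}\sum_{j\in V_i}\mathbf 1\{h_j[y_j]\le\gamma+\max_{k\ne y_j}h_j[k]\}$, and $\mathcal L^\gamma_i(h)$ is its expectation over the labels of $V_i$. **Assumptions on a test subgroup** $V_m$, $0<m\le M$. Put $\epsilon_m=\max_{j\in V_m}\min_{i\in V_0}\|g_i-g_j\|_2$, $B_m=\max_{i\in V_0\cup V_m}\|g_i\|_2$, and $$S_m=\frac{K\rho}{\sqrt{2\pi}\,\sigma}\big(\epsilon_m+|h_0-h_m|\,\rho\big).$$ 1. (Equal-sized disjoint near sets.) The sets $\{j\in V_m:\|g_i-g_j\|_2\le\epsilon_m\}$, $i\in V_0$, are pairwise disjoint and have the same positive size. 2. (Concentrated expected loss difference, with $0<\alpha<\frac14$ and a constant $c\ge0$.) If all entries of $W_1,\dots,W_L$ are drawn independently from $N(0,v)$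 with $v=\dfrac{(\gamma/(8\epsilon_m))^{2/L}}{2b\,(\lambda N_0^{-\alpha}+\ln(2bL))}$, $\lambda=N_0^{2\alpha}$, and $T_h=\max_l\|W_l\|_2$ (spectral norms), then $$\Pr\Big(\mathcal L_m^{\gamma/4}(h)-\mathcal L_0^{\gamma/2}(h)>N_0^{-\alpha}+c\,S_m\ \Big|\ T_h^L\epsilon_m>\tfrac\gamma8\Big)\le e^{-N_0^{2\alpha}} .$$ **Theorem.** For all $\mu_1,\mu_2,\sigma,B,c$ there is a constant $A>0$, depending only on these, such that for every architecture (depth $L$, layer widths, $b$), all $\gamma>0$, $C>0$, $0<\alpha<\frac14$ and $\epsilon_0>0$ there is $N_1$ with the following property. For every $G$, $X$, $V_0,\dots,V_M$, $(p_i,q_i)_i$ as above and every $0<m\le M$ such that $N_0\ge N_1$, $B_m\le B$, $\epsilon_m\ge\epsilon_0$ and the two assumptions hold for $V_m$, and for every $\delta\in(0,1)$: with probability at least $1-\delta$ over the training labels $(y_i)_{i\in V_0}$, all classifiers $\tilde h\in\mathcal H$, with parameters $\widetilde W_1,\dots,\widetilde W_L$, satisfy $$\mathcal L^0_m(\tilde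 h)\le\widehat{\mathcal L}^\gamma_0(\tilde h)+A\left(\frac{K\rho}{\sqrt{2\pi}\,\sigma}\big(\epsilon_m+|h_0-h_m|\rho\big)+\frac{b\sum_{l=1}^L\|\widetilde W_l\|_F^2}{(\gamma/8)^{2/L}N_0^{\alpha}}\,\epsilon_m^{2/L}+\mathbf R\right),$$ $$\mathbf R=\frac1{N_0^{1-2\alpha}}+\frac1{N_0^{2\alpha}}\ln\frac{\max\{1,\;LC(2B_m)^{1/L}\gamma^{-1/L}\}}{\delta}.$$ -/

import Mathlib

open MeasureTheory ProbabilityTheory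
open scoped ENNReal NNReal

noncomputable section

namespace SubgroupGNN

/-- Feature space `ℝ^D` with the Euclidean norm. -/
abbrev Feat (D : ℕ) : Type := EuclideanSpace ℝ (Fin D)

/-- The number `K` of classes: the contextual stochastic block model has two classes. -/
abbrev numClasses : ℕ := 2

/-- Labels. -/
abbrev Label : Type := Fin numClasses

/-! ### The generalized CSBM-S data model -/

/-- Intra-class and inter-class edge probabilities `p i`, `q i` of the subgroups: probabilities,
not both zero, with a common value of `p i + q i`. -/
structure IsGeneralizedCSBMS {M : ℕ} (p q : Fin (M + 1) → ℝ) : Prop where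
  p_mem : ∀ i, p i ∈ Set.Icc (0 : ℝ) 1
  q_mem : ∀ i, q i ∈ Set.Icc (0 : ℝ) 1
  pos : ∀ i, 0 < p i + q i
  same_degree : ∀ i j, p i + q i = p j + q j

/-- The homophily ratio of a structural pattern `(p, q)`. -/
def homophily (p q : ℝ) : ℝ := p / (p + q)

/-- Mean of the aggregated feature of a node of class `k` with structural pattern `(p, q)`:
`(p μ₁ + q μ₂) / (p + q)` in the first class, `(q μ₁ + p μ₂) / (p + q)` in the second. -/
def aggMean {D : ℕ} (μ₁ μ₂ : Feat D) (p q : ℝ) (k : Label) : Feat D :=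
  if k = 0 then (p + q)⁻¹ • (p • μ₁ + q • μ₂) else (p + q)⁻¹ • (q • μ₁ + p • μ₂)

/-- Density of the normal distribution `N(m, σ² I)` on `ℝ^D`. -/
def gaussDensity {D : ℕ} (σ : ℝ) (m f : Feat D) : ℝ :=
  (Real.sqrt (2 * Real.pi * σ ^ 2))⁻¹ ^ D * Real.exp (-‖f - m‖ ^ 2 / (2 * σ ^ 2))

/-- Prior probability of a class (balanced classes). -/
def classPrior (_k : Label) : ℝ := 1 / 2

/-- `Pr(y = k ∣ f)` for a node with pattern `(p, q)` and aggregated feature `f` (Bayes' rule). -/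
def classPosterior {D : ℕ} (μ₁ μ₂ : Feat D) (σ p q : ℝ) (f : Feat D) (k : Label) : ℝ :=
  classPrior k * gaussDensity σ (aggMean μ₁ μ₂ p q k) f /
    ∑ l : Label, classPrior l * gaussDensity σ (aggMean μ₁ μ₂ p q l) f

/-- The conditional distribution `Pr(y ∣ f)` as a measure on the labels. -/
def labelDist {D : ℕ} (μ₁ μ₂ : Feat D) (σ p q : ℝ) (f : Feat D) : Measure Label :=
  ∑ k : Label, ENNReal.ofReal (classPosterior μ₁ μ₂ σ p q f k) • Measure.dirac k

/-! ### Aggregation -/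

open Classical in
/-- One-hop mean aggregation `g_i(X, G) = |N(i)|⁻¹ ∑_{j ∈ N(i)} X_j`. -/
def aggregate {n D : ℕ} (G : SimpleGraph (Fin n)) (X : Fin n → Feat D) (i : Fin n) : Feat D :=
  ((Finset.univ.filter fun j => G.Adj i j).card : ℝ)⁻¹ •
    ∑ j ∈ Finset.univ.filter fun j => G.Adj i j, X j

/-! ### The ReLU network -/

/-- Width of layer `l`: the input layer `0` has width `D`, the output layer `L` has one unit per
class, and the hidden layer `l` (`0 < l < L`) has width `w l`. -/
def width (D L : ℕ) (w : ℕ → ℕ) : ℕ → ℕ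
  | 0 => D
  | l + 1 => if l + 1 = L then numClasses else w (l + 1)

theorem width_last (D L : ℕ) [NeZero L] (w : ℕ → ℕ) : width D L w L = numClasses := by
  obtain ⟨l, rfl⟩ := Nat.exists_eq_succ_of_ne_zero (NeZero.ne L)
  simp [width]

/-- The vectorized parameters: one real number per entry of `W_1, …, W_L`. The matrix with index
`l : Fin L` is `W_{l+1}`, mapping layer `l` to layer `l + 1`. -/
abbrev Params (D L : ℕ) (w : ℕ → ℕ) : Type :=
  (Σ l : Fin L, Fin (width D L w (l + 1)) × Fin (width D L w l)) → ℝ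

/-- The weight matrices. -/
def weight {D L : ℕ} {w : ℕ → ℕ} (θ : Params D L w) (l : Fin L) :
    Matrix (Fin (width D L w (l + 1))) (Fin (width D L w l)) ℝ :=
  Matrix.of fun i j => θ ⟨l, i, j⟩

/-- Pre-activations of layer `l`; the input is used as it is, and ReLU acts on hidden layers. -/
def preact {D L : ℕ} {w : ℕ → ℕ} (θ : Params D L w) (x : Feat D) :
    (l : ℕ) → l ≤ L → Fin (width D L w l) → ℝ
  | 0, _ => fun i => x i
  | l + 1, h => Matrix.mulVec (weight θ ⟨l, h⟩) fun j =>
      if l = 0 then preact θ x l (Nat.le_of_succ_le h) j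
      else max (preact θ x l (Nat.le_of_succ_le h) j) 0

/-- Output logits `f(x; W_1, …, W_L) ∈ ℝ^K`. -/
def logits {D L : ℕ} [NeZero L] {w : ℕ → ℕ} (θ : Params D L w) (x : Feat D) (k : Label) : ℝ :=
  preact θ x L le_rfl (Fin.cast (width_last D L w).symm k)

/-- Squared Frobenius norm. -/
def frobSq {m n : ℕ} (W : Matrix (Fin m) (Fin n) ℝ) : ℝ := ∑ i, ∑ j, W i j ^ 2

/-- Spectral norm. -/
def specNorm {m n : ℕ} (W : Matrix (Fin m) (Fin n) ℝ) : ℝ :=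
  ‖(Matrix.toEuclideanLin W).toContinuousLinearMap‖

/-- `T_h`, the largest spectral norm of a layer. -/
def maxSpec {D L : ℕ} {w : ℕ → ℕ} (θ : Params D L w) : ℝ := ⨆ l : Fin L, specNorm (weight θ l)

/-- The distribution of the network with vectorized parameters drawn from `N(0, v I)`. -/
def prior (D L : ℕ) (w : ℕ → ℕ) (v : ℝ) : Measure (Params D L w) :=
  Measure.pi fun _ => gaussianReal 0 v.toNNReal

/-! ### Margin losses on a set `S` of nodes with aggregated features `g` -/

open Classical in
/-- The `0`-`1` margin loss of the logits `z` at the label `y`. -/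
def marginLoss (γ : ℝ) (z : Label → ℝ) (y : Label) : ℝ :=
  if z y ≤ γ + ⨆ k : {k : Label // k ≠ y}, z k then 1 else 0

/-- Empirical margin loss. -/
def empLoss {n D L : ℕ} [NeZero L] {w : ℕ → ℕ} (g : Fin n → Feat D) (S : Finset (Fin n)) (γ : ℝ)
    (θ : Params D L w) (y : S → Label) : ℝ :=
  (S.card : ℝ)⁻¹ * ∑ i : S, marginLoss γ (logits θ (g i)) (y i)

/-- Law of the labels of `S` given the aggregated features: independent,
`y_i ∼ Pr(y ∣ g_i)`, when `S` has the structural pattern `(p, q)`. -/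
def labelLaw {n D : ℕ} (μ₁ μ₂ : Feat D) (σ p q : ℝ) (g : Fin n → Feat D) (S : Finset (Fin n)) :
    Measure (S → Label) :=
  Measure.pi fun i : S => labelDist μ₁ μ₂ σ p q (g i)

/-- Expected margin loss. -/
def expLoss {n D L : ℕ} [NeZero L] {w : ℕ → ℕ} (μ₁ μ₂ : Feat D) (σ p q : ℝ)
    (g : Fin n → Feat D) (S : Finset (Fin n)) (γ : ℝ) (θ : Params D L w) : ℝ :=
  ∫ y, empLoss g S γ θ y ∂labelLaw μ₁ μ₂ σ p q g S

/-! ### Geometry of a test subgroup `V` relative to the training nodes `V₀` -/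

/-- `ε = max_{j ∈ V} min_{i ∈ V₀} ‖g_i - g_j‖`. -/
def featDist {n D : ℕ} (g : Fin n → Feat D) (V₀ V : Finset (Fin n)) : ℝ :=
  ⨆ j : V, ⨅ i : V₀, ‖g i - g j‖

open Classical in
/-- The near set of the training node `i` with respect to `V`. -/
def nearSet {n D : ℕ} (g : Fin n → Feat D) (V₀ V : Finset (Fin n)) (i : Fin n) :
    Finset (Fin n) :=
  V.filter fun j => ‖g i - g j‖ ≤ featDist g V₀ V

/-- The near sets of the training nodes are disjoint and have the same positive size. -/
def EqualDisjointNearSets {n D : ℕ} (g : Fin n → Feat D) (V₀ V : Finset (Fin n)) : Prop :=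
  (∀ i ∈ V₀, ∀ j ∈ V₀, i ≠ j → Disjoint (nearSet g V₀ V i) (nearSet g V₀ V j)) ∧
    ∃ s : ℕ, 0 < s ∧ ∀ i ∈ V₀, (nearSet g V₀ V i).card = s

/-- `B = max_{i ∈ V₀ ∪ V} ‖g_i‖`. -/
def maxNorm {n D : ℕ} (g : Fin n → Feat D) (V₀ V : Finset (Fin n)) : ℝ :=
  ⨆ i : {i : Fin n // i ∈ V₀ ∨ i ∈ V}, ‖g i‖

/-- `(K ρ / (√(2π) σ)) (ε + Δ ρ)`, where `ρ = ‖μ₁ - μ₂‖`, `ε` is a feature distance and `Δ` a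
difference of homophily ratios. -/
def shiftTerm {D : ℕ} (μ₁ μ₂ : Feat D) (σ ε Δ : ℝ) : ℝ :=
  (numClasses : ℝ) * ‖μ₁ - μ₂‖ / (Real.sqrt (2 * Real.pi) * σ) * (ε + Δ * ‖μ₁ - μ₂‖)

/-- `(γ / (8 ε))^{2/L} / (2 b (λ N^{-α} + ln (2 b L)))` with `λ = N^{2α}`. -/
def priorVar (L b : ℕ) (γ ε α : ℝ) (N : ℕ) : ℝ :=
  (γ / (8 * ε)) ^ (2 / (L : ℝ)) /
    (2 * b * ((N : ℝ) ^ (2 * α) * (N : ℝ) ^ (-α) + Real.log (2 * b * L)))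

/-- Concentrated expected loss difference: for `h` drawn from the Gaussian prior and conditionally
on `T_h^L ε > γ/8`, the expected `γ/4`-loss on `V` exceeds the expected `γ/2`-loss on `V₀` by more
than `N₀^{-α} + c (K ρ / (√(2π) σ)) (ε + |h₀ - h_V| ρ)` with probability at most
`exp (-N₀^{2α})`. -/
def ConcentratedLossDiff {n D : ℕ} (L : ℕ) [NeZero L] (w : ℕ → ℕ) (b : ℕ)
    (μ₁ μ₂ : Feat D) (σ c γ α : ℝ) (g : Fin n → Feat D)
    (V₀ V : Finset (Fin n)) (p₀ q₀ p q : ℝ) : Prop :=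
  (prior D L w (priorVar L b γ (featDist g V₀ V) α V₀.card))[
      {θ | expLoss μ₁ μ₂ σ p q g V (γ / 4) θ - expLoss μ₁ μ₂ σ p₀ q₀ g V₀ (γ / 2) θ >
        (V₀.card : ℝ) ^ (-α) +
          c * shiftTerm μ₁ μ₂ σ (featDist g V₀ V) |homophily p₀ q₀ - homophily p q|} |
      {θ | maxSpec θ ^ L * featDist g V₀ V > γ / 8}]
    ≤ ENNReal.ofReal (Real.exp (-(V₀.card : ℝ) ^ (2 * α)))

/-- `(b ∑_l ‖W_l‖_F² / ((γ/8)^{2/L} N^α)) ε^{2/L}`. -/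
def normTerm {D L : ℕ} {w : ℕ → ℕ} (b : ℕ) (γ α ε : ℝ) (N : ℕ) (θ : Params D L w) : ℝ :=
  b * (∑ l : Fin L, frobSq (weight θ l)) / ((γ / 8) ^ (2 / (L : ℝ)) * (N : ℝ) ^ α) *
    ε ^ (2 / (L : ℝ))

/-- `N^{-(1-2α)} + N^{-2α} ln (max (1, L C (2B)^{1/L} / γ^{1/L}) / δ)`. -/
def remainder (L : ℕ) (γ α C B δ : ℝ) (N : ℕ) : ℝ :=
  1 / (N : ℝ) ^ (1 - 2 * α) + 1 / (N : ℝ) ^ (2 * α) *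
    Real.log (max 1 (L * C * (2 * B) ^ (1 / (L : ℝ)) / γ ^ (1 / (L : ℝ))) / δ)

end SubgroupGNN

end

noncomputable section

namespace SubgroupGNN

/-! ### Norm bounds for the network -/

/-! The threshold `N₁` may depend on the architecture and on `γ`, `C`, `α`, `ε₀`, so any constant
attached to the compact set of admissible parameters is eventually beaten by a power of `N₀`.
Compactness and a union bound over a finite net therefore suffice, and the slack between the margins
`0` and `γ` pays for every perturbation of parameters or features.

Training side. Hoeffding on a finite net `F` (`ofReal_one_sub_le_labelLaw`) gives a deviation `x + τ
N₀^{-α}`, where `x` is at most the remainder and `τ N₀^{-α}` pays for `ln |F|`. The latter is at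
most the norm term: either no training margin exceeds `γ`, the empirical loss is `1` and the bound
is trivial, or `T_h^L ≥ γ/(2B)`, which bounds the Frobenius norms from below
(`empLoss_eq_one_or_le_maxSpec_pow`, `mul_rpow_neg_le_normTerm`).

From test to training. If `T_h^L ε ≤ γ/8`, logits differ by at most `γ/8` between a training node
and its near set, and the posteriors, logistic functions of an affine log-odds, differ by a multiple
of the shift term (`expLoss_le_expLoss_of_maxSpec`). If `T_h^L ε > γ/8`, the norm term is at least
`N₀^{-α}`. The prior variance is of order `N₀^{-α}`, so a fixed small ball around the parameters has
mass at least `exp(-O(N₀^α))`, more than `exp(-N₀^{2α})` (`exists_forall_lt_prior_ball`). By the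
concentration assumption the ball contains a point with small spectral norms or small loss
difference (`exists_mem_ball_of_concentratedLossDiff`), and uniform continuity carries the estimate
back to the centre. -/

theorem specNorm_nonneg {m n : ℕ} (W : Matrix (Fin m) (Fin n) ℝ) : 0 ≤ specNorm W :=
  norm_nonneg _

theorem norm_mulVec_le_specNorm {m n : ℕ} (W : Matrix (Fin m) (Fin n) ℝ) (v : Fin n → ℝ) :
    ‖WithLp.toLp 2 (W.mulVec v)‖ ≤ specNorm W * ‖WithLp.toLp 2 v‖ := by
  have h := (Matrix.toEuclideanLin W).toContinuousLinearMap.le_opNorm (WithLp.toLp 2 v)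
  simpa [specNorm, Matrix.toLpLin_toLp] using h

theorem frobSq_nonneg {m n : ℕ} (W : Matrix (Fin m) (Fin n) ℝ) : 0 ≤ frobSq W :=
  Finset.sum_nonneg fun _ _ => Finset.sum_nonneg fun _ _ => sq_nonneg _

theorem specNorm_le_sqrt_frobSq {m n : ℕ} (W : Matrix (Fin m) (Fin n) ℝ) :
    specNorm W ≤ Real.sqrt (frobSq W) := by
  refine ContinuousLinearMap.opNorm_le_bound _ (Real.sqrt_nonneg _) fun x => ?_
  rw [EuclideanSpace.norm_eq, EuclideanSpace.norm_eq, ← Real.sqrt_mul (frobSq_nonneg W)]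
  refine Real.sqrt_le_sqrt ?_
  rw [frobSq, Finset.sum_mul]
  refine Finset.sum_le_sum fun i _ => ?_
  have h := Finset.sum_mul_sq_le_sq_mul_sq Finset.univ (fun j => W i j) (fun j => x j)
  simpa [Matrix.toLpLin_apply, Matrix.mulVec, dotProduct, sq_abs] using h

variable {D L : ℕ} {w : ℕ → ℕ}

theorem specNorm_le_maxSpec (θ : Params D L w) (l : Fin L) :
    specNorm (weight θ l) ≤ maxSpec θ :=
  le_ciSup (f := fun l : Fin L => specNorm (weight θ l)) (Set.finite_range _).bddAbove l

theorem maxSpec_nonneg (θ : Params D L w) : 0 ≤ maxSpec θ :=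
  Real.iSup_nonneg fun _ => specNorm_nonneg _

theorem maxSpec_le_sqrt_sum_frobSq (θ : Params D L w) :
    maxSpec θ ≤ Real.sqrt (∑ l : Fin L, frobSq (weight θ l)) := by
  refine Real.iSup_le (fun l => ?_) (Real.sqrt_nonneg _)
  refine (specNorm_le_sqrt_frobSq _).trans (Real.sqrt_le_sqrt ?_)
  exact Finset.single_le_sum (f := fun l : Fin L => frobSq (weight θ l))
    (fun _ _ => frobSq_nonneg _) (Finset.mem_univ l)

theorem norm_toLp_le_of_abs_le {n : ℕ} {u v : Fin n → ℝ} (h : ∀ i, |u i| ≤ |v i|) :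
    ‖WithLp.toLp 2 u‖ ≤ ‖WithLp.toLp 2 v‖ := by
  rw [EuclideanSpace.norm_eq, EuclideanSpace.norm_eq]
  refine Real.sqrt_le_sqrt (Finset.sum_le_sum fun i _ => ?_)
  simpa using sq_le_sq.2 (by simpa using h i)

/-- Each layer multiplies distances by at most its spectral norm, and ReLU is 1-Lipschitz in every
coordinate. -/
theorem norm_preact_sub_le (θ : Params D L w) (x x' : Feat D) :
    ∀ (l : ℕ) (h : l ≤ L),
      ‖WithLp.toLp 2 (preact θ x l h - preact θ x' l h)‖ ≤ maxSpec θ ^ l * ‖x - x'‖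
  | 0, h => by
    rw [pow_zero, one_mul]
    exact le_of_eq rfl
  | l + 1, h => by
    have ih := norm_preact_sub_le θ x x' l (Nat.le_of_succ_le h)
    rw [preact, preact, ← Matrix.mulVec_sub, pow_succ', mul_assoc]
    refine (norm_mulVec_le_specNorm _ _).trans ?_
    refine mul_le_mul (specNorm_le_maxSpec θ _) (le_trans ?_ ih) (norm_nonneg _)
      (maxSpec_nonneg θ)
    refine norm_toLp_le_of_abs_le fun i => ?_
    simp only [Pi.sub_apply]
    split_ifs
    · exact le_rfl
    · exact abs_max_sub_max_le_abs _ _ _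

theorem preact_zero (θ : Params D L w) : ∀ (l : ℕ) (h : l ≤ L), preact θ 0 l h = 0
  | 0, h => rfl
  | l + 1, h => by
    have ih := preact_zero θ l (Nat.le_of_succ_le h)
    rw [preact, ih]
    simp only [Pi.zero_apply, max_self, ite_self]
    exact Matrix.mulVec_zero _

theorem abs_logits_sub_le [NeZero L] (θ : Params D L w) (x x' : Feat D) (k : Label) :
    |logits θ x k - logits θ x' k| ≤ maxSpec θ ^ L * ‖x - x'‖ := by
  refine le_trans ?_ (norm_preact_sub_le θ x x' L le_rfl)
  exact PiLp.norm_apply_le (WithLp.toLp 2 (preact θ x L le_rfl - preact θ x' L le_rfl)) _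

theorem abs_logits_le [NeZero L] (θ : Params D L w) (x : Feat D) (k : Label) :
    |logits θ x k| ≤ maxSpec θ ^ L * ‖x‖ := by
  have h := abs_logits_sub_le θ x 0 k
  rwa [logits, logits, preact_zero, Pi.zero_apply, sub_zero, sub_zero] at h

theorem continuous_preact : ∀ (l : ℕ) (h : l ≤ L) (i : Fin (width D L w l)),
    Continuous fun z : Params D L w × Feat D => preact z.1 z.2 l h i
  | 0, h, i => by
    simp only [preact]
    fun_prop
  | l + 1, h, i => by
    have ih := continuous_preact l (Nat.le_of_succ_le h)
    simp only [preact, Matrix.mulVec, dotProduct, weight, Matrix.of_apply]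
    refine continuous_finsetSum _ fun j _ => Continuous.mul (by fun_prop) ?_
    split_ifs
    · exact ih j
    · exact (ih j).max continuous_const

theorem continuous_logits [NeZero L] (k : Label) :
    Continuous fun z : Params D L w × Feat D => logits z.1 z.2 k :=
  continuous_preact L le_rfl _

/-- Uniform continuity on a compact set. No explicit modulus is needed, since `r` only influences
`N₁`; `r ≤ 1` keeps a ball centred in the ball of radius `C` inside that of radius `C + 1`. -/
theorem exists_forall_abs_logits_sub_le (D L : ℕ) [NeZero L] (w : ℕ → ℕ) (R B : ℝ) {η : ℝ}
    (hη : 0 < η) :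
    ∃ r : ℝ, 0 < r ∧ r ≤ 1 ∧ ∀ θ θ' : Params D L w, ‖θ‖ ≤ R → ‖θ'‖ ≤ R → dist θ θ' < r →
      ∀ x : Feat D, ‖x‖ ≤ B → ∀ k, |logits θ x k - logits θ' x k| ≤ η := by
  have hcomp : IsCompact (Metric.closedBall (0 : Params D L w) R ×ˢ
      Metric.closedBall (0 : Feat D) B) :=
    (isCompact_closedBall _ _).prod (isCompact_closedBall _ _)
  have hcont : Continuous fun z : Params D L w × Feat D => fun k => logits z.1 z.2 k :=
    continuous_pi fun k => continuous_logits k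
  obtain ⟨r, hr, h⟩ := Metric.uniformContinuousOn_iff.1
    (hcomp.uniformContinuousOn_of_continuous hcont.continuousOn) η hη
  refine ⟨min r 1, lt_min hr one_pos, min_le_right _ _, fun θ θ' hθ hθ' hd x hx k => ?_⟩
  have := h (θ, x) ⟨by simpa using hθ, by simpa using hx⟩ (θ', x)
    ⟨by simpa using hθ', by simpa using hx⟩
    (by simpa [Prod.dist_eq, hr] using hd.trans_le (min_le_left _ _))
  exact (dist_le_pi_dist (fun k => logits θ x k) (fun k => logits θ' x k) k).trans this.le

theorem norm_le_of_sqrt_frobSq_le {C : ℝ} (hC : 0 ≤ C) (θ : Params D L w)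
    (h : ∀ l, Real.sqrt (frobSq (weight θ l)) ≤ C) : ‖θ‖ ≤ C := by
  refine (pi_norm_le_iff_of_nonneg hC).2 fun ⟨l, i, j⟩ => le_trans ?_ (h l)
  refine Real.le_sqrt_of_sq_le ?_
  rw [Real.norm_eq_abs, sq_abs]
  calc θ ⟨l, i, j⟩ ^ 2 ≤ ∑ j', weight θ l i j' ^ 2 :=
        Finset.single_le_sum (f := fun j' => weight θ l i j' ^ 2)
          (fun _ _ => sq_nonneg _) (Finset.mem_univ j)
    _ ≤ frobSq (weight θ l) :=
        Finset.single_le_sum (f := fun i' => ∑ j', weight θ l i' j' ^ 2)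
          (fun _ _ => Finset.sum_nonneg fun _ _ => sq_nonneg _) (Finset.mem_univ i)

end SubgroupGNN

end

noncomputable section

namespace SubgroupGNN

/-! ### The posterior as a logistic function -/

/-- The log-odds of the first class at the feature `f` for the homophily ratio `h`. -/
def logOdds {D : ℕ} (μ₁ μ₂ : Feat D) (σ h : ℝ) (f : Feat D) : ℝ :=
  (2 * h - 1) * inner ℝ ((2 : ℝ) • f - (μ₁ + μ₂)) (μ₁ - μ₂) / (2 * σ ^ 2)

theorem abs_sigmoid_sub_le (x y : ℝ) : |Real.sigmoid x - Real.sigmoid y| ≤ |x - y| := by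
  have h := Convex.norm_image_sub_le_of_norm_deriv_le (f := Real.sigmoid) (C := 1)
    (s := Set.univ) (x := y) (y := x) (fun z _ => differentiable_sigmoid z) (fun z _ => ?_)
    convex_univ (Set.mem_univ _) (Set.mem_univ _)
  · simpa using h
  · rw [Real.deriv_sigmoid, Real.norm_eq_abs, abs_le]
    have h0 := Real.sigmoid_pos z
    have h1 := Real.sigmoid_lt_one z
    constructor <;> nlinarith

/-- The class means are convex combinations of `μ₁`, `μ₂` with weights `h`, `1 - h` in opposite
order, and the covariances agree; the terms quadratic in `f` cancel and the log-odds become affine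
in `f`. -/
theorem norm_sub_aggMean_sq_sub {D : ℕ} (μ₁ μ₂ : Feat D) {p q : ℝ} (hpq : 0 < p + q)
    (f : Feat D) :
    ‖f - aggMean μ₁ μ₂ p q 1‖ ^ 2 - ‖f - aggMean μ₁ μ₂ p q 0‖ ^ 2 =
      (2 * homophily p q - 1) * inner ℝ ((2 : ℝ) • f - (μ₁ + μ₂)) (μ₁ - μ₂) := by
  have h0 : f - aggMean μ₁ μ₂ p q 0 =
      f - (homophily p q • μ₁ + (1 - homophily p q) • μ₂) := by
    have : (p + q)⁻¹ * q = 1 - homophily p q := by rw [homophily]; field_simp; ring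
    simp only [aggMean, if_true, smul_add, smul_smul, this]
    rw [homophily, div_eq_inv_mul]
  have h1 : f - aggMean μ₁ μ₂ p q 1 =
      f - ((1 - homophily p q) • μ₁ + homophily p q • μ₂) := by
    have : (p + q)⁻¹ * q = 1 - homophily p q := by rw [homophily]; field_simp; ring
    simp only [aggMean, one_ne_zero, if_false, smul_add, smul_smul, this]
    rw [homophily, div_eq_inv_mul]
  rw [h0, h1]
  generalize homophily p q = h
  simp only [← real_inner_self_eq_norm_sq, inner_sub_left, inner_sub_right, inner_add_left,
    inner_add_right, inner_smul_left, inner_smul_right, real_inner_comm μ₁ f,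
    real_inner_comm μ₂ f, real_inner_comm μ₂ μ₁, RCLike.conj_to_real]
  ring

theorem classPosterior_zero {D : ℕ} (μ₁ μ₂ : Feat D) {σ p q : ℝ} (hσ : 0 < σ)
    (hpq : 0 < p + q) (f : Feat D) :
    classPosterior μ₁ μ₂ σ p q f 0 = Real.sigmoid (logOdds μ₁ μ₂ σ (homophily p q) f) := by
  have hodds : logOdds μ₁ μ₂ σ (homophily p q) f =
      -‖f - aggMean μ₁ μ₂ p q 0‖ ^ 2 / (2 * σ ^ 2) -
        -‖f - aggMean μ₁ μ₂ p q 1‖ ^ 2 / (2 * σ ^ 2) := by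
    rw [logOdds, ← norm_sub_aggMean_sq_sub μ₁ μ₂ hpq f]
    ring
  have hK : 0 < (Real.sqrt (2 * Real.pi * σ ^ 2))⁻¹ ^ D := by positivity
  rw [hodds, Real.sigmoid_def, neg_sub, Real.exp_sub]
  simp only [classPosterior, classPrior, gaussDensity, Fin.sum_univ_two]
  field_simp

theorem gaussDensity_pos {D : ℕ} {σ : ℝ} (hσ : 0 < σ) (m f : Feat D) :
    0 < gaussDensity σ m f := by
  rw [gaussDensity]
  positivity

theorem classPosterior_zero_add_one {D : ℕ} (μ₁ μ₂ : Feat D) {σ : ℝ} (p q : ℝ) (hσ : 0 < σ)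
    (f : Feat D) :
    classPosterior μ₁ μ₂ σ p q f 0 + classPosterior μ₁ μ₂ σ p q f 1 = 1 := by
  have h0 := gaussDensity_pos hσ (aggMean μ₁ μ₂ p q 0) f
  have h1 := gaussDensity_pos hσ (aggMean μ₁ μ₂ p q 1) f
  simp only [classPosterior, classPrior, Fin.sum_univ_two]
  field_simp

theorem classPosterior_nonneg {D : ℕ} (μ₁ μ₂ : Feat D) {σ : ℝ} (p q : ℝ) (hσ : 0 < σ)
    (f : Feat D) (k : Label) : 0 ≤ classPosterior μ₁ μ₂ σ p q f k := by
  have h := fun l => gaussDensity_pos hσ (aggMean μ₁ μ₂ p q l) f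
  refine div_nonneg (mul_nonneg (by norm_num [classPrior]) (h k).le) ?_
  exact Finset.sum_nonneg fun l _ => mul_nonneg (by norm_num [classPrior]) (h l).le

theorem abs_classPosterior_sub_le {D : ℕ} (μ₁ μ₂ : Feat D) {σ p q p' q' : ℝ} (hσ : 0 < σ)
    (hpq : 0 < p + q) (hpq' : 0 < p' + q') (f f' : Feat D) (k : Label) :
    |classPosterior μ₁ μ₂ σ p q f k - classPosterior μ₁ μ₂ σ p' q' f' k| ≤
      |logOdds μ₁ μ₂ σ (homophily p q) f - logOdds μ₁ μ₂ σ (homophily p' q') f'| := by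
  have h0 : |classPosterior μ₁ μ₂ σ p q f 0 - classPosterior μ₁ μ₂ σ p' q' f' 0| ≤
      |logOdds μ₁ μ₂ σ (homophily p q) f - logOdds μ₁ μ₂ σ (homophily p' q') f'| := by
    rw [classPosterior_zero μ₁ μ₂ hσ hpq, classPosterior_zero μ₁ μ₂ hσ hpq']
    exact abs_sigmoid_sub_le _ _
  have e := classPosterior_zero_add_one μ₁ μ₂ p q hσ f
  have e' := classPosterior_zero_add_one μ₁ μ₂ p' q' hσ f'
  fin_cases k
  · exact h0
  · refine le_trans (le_of_eq ?_) h0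
    rw [abs_sub_comm]
    congr 1
    change classPosterior μ₁ μ₂ σ p' q' f' 1 - classPosterior μ₁ μ₂ σ p q f 1 = _
    linarith

/-- The constant relating differences of posteriors to `shiftTerm` for features of norm at most
`B`. -/
def shiftConst {D : ℕ} (μ₁ μ₂ : Feat D) (σ B : ℝ) : ℝ :=
  Real.sqrt (2 * Real.pi) / σ * max 1 ((2 * B + ‖μ₁ + μ₂‖) / ‖μ₁ - μ₂‖)

theorem shiftConst_nonneg {D : ℕ} (μ₁ μ₂ : Feat D) {σ : ℝ} (hσ : 0 < σ) (B : ℝ) :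
    0 ≤ shiftConst μ₁ μ₂ σ B :=
  mul_nonneg (by positivity) (zero_le_one.trans (le_max_left _ _))

theorem homophily_mem_Icc {p q : ℝ} (hp : 0 ≤ p) (hq : 0 ≤ q) (hpq : 0 < p + q) :
    homophily p q ∈ Set.Icc (0 : ℝ) 1 :=
  ⟨div_nonneg hp hpq.le, (div_le_one hpq).2 (by linarith)⟩

theorem two_mul_abs_logOdds_sub_le {D : ℕ} (μ₁ μ₂ : Feat D) {σ B h h' ε : ℝ} (hσ : 0 < σ)
    (hh : h ∈ Set.Icc (0 : ℝ) 1) {f f' : Feat D} (hf' : ‖f'‖ ≤ B)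
    (hε : ‖f - f'‖ ≤ ε) :
    2 * |logOdds μ₁ μ₂ σ h f - logOdds μ₁ μ₂ σ h' f'| ≤
      shiftConst μ₁ μ₂ σ B * shiftTerm μ₁ μ₂ σ ε |h' - h| := by
  set Q := 2 * B + ‖μ₁ + μ₂‖ with hQ
  set ρ := ‖μ₁ - μ₂‖ with hρ
  have hρ0 : 0 ≤ ρ := norm_nonneg _
  have hε0 : 0 ≤ ε := (norm_nonneg _).trans hε
  -- Change the feature at fixed ratio `h`, then the ratio at fixed feature `f'`; hence only `h ∈
  -- [0, 1]` and a bound on `‖f'‖` are needed.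
  have hdec : logOdds μ₁ μ₂ σ h f - logOdds μ₁ μ₂ σ h' f' =
      ((2 * h - 1) * (2 * inner ℝ (f - f') (μ₁ - μ₂)) -
        2 * (h' - h) * inner ℝ ((2 : ℝ) • f' - (μ₁ + μ₂)) (μ₁ - μ₂)) / (2 * σ ^ 2) := by
    simp only [logOdds, inner_sub_left, inner_smul_left, RCLike.conj_to_real]
    ring
  have hI₁ : |inner ℝ (f - f') (μ₁ - μ₂)| ≤ ε * ρ :=
    (abs_real_inner_le_norm _ _).trans (by gcongr)
  have hI₂ : |inner ℝ ((2 : ℝ) • f' - (μ₁ + μ₂)) (μ₁ - μ₂)| ≤ Q * ρ := by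
    refine (abs_real_inner_le_norm _ _).trans ?_
    gcongr
    refine (norm_sub_le _ _).trans ?_
    rw [norm_smul, Real.norm_eq_abs, abs_two]
    linarith
  have hc : |2 * h - 1| ≤ 1 := abs_le.2 ⟨by linarith [hh.1], by linarith [hh.2]⟩
  have hnum : |logOdds μ₁ μ₂ σ h f - logOdds μ₁ μ₂ σ h' f'| ≤
      (ρ * (ε + |h' - h| * Q)) / σ ^ 2 := by
    rw [hdec, abs_div, abs_of_pos (by positivity : 0 < 2 * σ ^ 2), div_le_div_iff₀
      (by positivity) (by positivity)]
    have : |(2 * h - 1) * (2 * inner ℝ (f - f') (μ₁ - μ₂)) -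
        2 * (h' - h) * inner ℝ ((2 : ℝ) • f' - (μ₁ + μ₂)) (μ₁ - μ₂)| ≤
        1 * (2 * (ε * ρ)) + 2 * |h' - h| * (Q * ρ) := by
      refine (abs_sub _ _).trans ?_
      rw [abs_mul, abs_mul, abs_mul, abs_mul, abs_two]
      gcongr
    nlinarith [sq_nonneg σ]
  -- For `ρ = 0` the quotient `Q / ρ` is the default `0`, but then both sides vanish.
  rcases hρ0.eq_or_lt with h0 | hpos
  · rw [← h0, zero_mul, zero_div] at hnum
    rw [shiftTerm, ← hρ, ← h0]
    simp only [mul_zero, zero_div, zero_mul]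
    linarith
  · have hmain : ε + |h' - h| * Q ≤ max 1 (Q / ρ) * (ε + |h' - h| * ρ) := by
      have h1 : ε ≤ max 1 (Q / ρ) * ε := le_mul_of_one_le_left hε0 (le_max_left _ _)
      have h2 : Q ≤ max 1 (Q / ρ) * ρ := by
        calc Q = Q / ρ * ρ := by field_simp
          _ ≤ _ := by gcongr; exact le_max_right _ _
      have h3 := mul_le_mul_of_nonneg_left h2 (abs_nonneg (h' - h))
      linarith
    calc 2 * |logOdds μ₁ μ₂ σ h f - logOdds μ₁ μ₂ σ h' f'|
        ≤ 2 * ((ρ * (max 1 (Q / ρ) * (ε + |h' - h| * ρ))) / σ ^ 2) := by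
          refine mul_le_mul_of_nonneg_left (hnum.trans ?_) zero_le_two
          gcongr
      _ = shiftConst μ₁ μ₂ σ B * shiftTerm μ₁ μ₂ σ ε |h' - h| := by
          rw [shiftConst, shiftTerm, ← hρ, ← hQ, numClasses]
          have : Real.sqrt (2 * Real.pi) ≠ 0 := by positivity
          push_cast
          field_simp

/-! ### Margin losses -/

theorem iSup_ne_label (z : Label → ℝ) (y : Label) :
    ⨆ k : {k : Label // k ≠ y}, z k = z (1 - y) := by
  have hne : (1 : Label) - y ≠ y := by fin_cases y <;> decide
  have : Unique {k : Label // k ≠ y} :=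
    { default := ⟨1 - y, hne⟩
      uniq := fun ⟨k, hk⟩ => Subtype.ext <| by
        change k = 1 - y
        revert hk
        fin_cases y <;> fin_cases k <;> decide }
  rw [ciSup_unique]
  exact congrArg z (congrArg Subtype.val (Unique.default_eq ⟨1 - y, hne⟩))

theorem marginLoss_mem_Icc (γ : ℝ) (z : Label → ℝ) (y : Label) :
    marginLoss γ z y ∈ Set.Icc (0 : ℝ) 1 := by
  unfold marginLoss
  split_ifs <;> simp

/-- The margin is a difference of two logits, so it moves by at most `2 * η`. -/
theorem marginLoss_le_marginLoss {γ γ' η : ℝ} {z z' : Label → ℝ}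
    (hz : ∀ k, |z k - z' k| ≤ η) (hγ : γ + 2 * η ≤ γ') (y : Label) :
    marginLoss γ z y ≤ marginLoss γ' z' y := by
  unfold marginLoss
  rw [iSup_ne_label, iSup_ne_label]
  have h1 := abs_le.1 (hz y)
  have h2 := abs_le.1 (hz (1 - y))
  split_ifs with h h'
  · exact le_rfl
  · exact absurd (by linarith) h'
  · exact zero_le_one
  · exact le_rfl

variable {n D L : ℕ} [NeZero L] {w : ℕ → ℕ}

theorem empLoss_le_one (g : Fin n → Feat D) (S : Finset (Fin n)) (γ : ℝ) (θ : Params D L w)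
    (y : S → Label) : empLoss g S γ θ y ≤ 1 := by
  rw [empLoss]
  refine inv_mul_le_one_of_le₀ ?_ (Nat.cast_nonneg _)
  calc _ ≤ ∑ _i : S, (1 : ℝ) := Finset.sum_le_sum fun i _ => (marginLoss_mem_Icc _ _ _).2
    _ = _ := by simp

theorem empLoss_mono {g : Fin n → Feat D} {S : Finset (Fin n)} {γ γ' η : ℝ}
    {θ θ' : Params D L w} (hz : ∀ i ∈ S, ∀ k, |logits θ (g i) k - logits θ' (g i) k| ≤ η)
    (hγ : γ + 2 * η ≤ γ') (y : S → Label) : empLoss g S γ θ y ≤ empLoss g S γ' θ' y := by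
  unfold empLoss
  gcongr with i
  exact marginLoss_le_marginLoss (hz i i.2) hγ _

/-- Expected margin loss of one node. -/
def nodeLoss (μ₁ μ₂ : Feat D) (σ p q : ℝ) (f : Feat D) (γ : ℝ) (z : Label → ℝ) : ℝ :=
  ∑ k, classPosterior μ₁ μ₂ σ p q f k * marginLoss γ z k

theorem isProbabilityMeasure_labelDist (μ₁ μ₂ : Feat D) {σ : ℝ} (p q : ℝ) (hσ : 0 < σ)
    (f : Feat D) : IsProbabilityMeasure (labelDist μ₁ μ₂ σ p q f) := by
  refine ⟨?_⟩
  simp only [labelDist, Fin.sum_univ_two, Measure.add_apply, Measure.smul_apply, measure_univ,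
    smul_eq_mul, mul_one]
  rw [← ENNReal.ofReal_add (classPosterior_nonneg _ _ _ _ hσ _ _)
    (classPosterior_nonneg _ _ _ _ hσ _ _), classPosterior_zero_add_one _ _ _ _ hσ,
    ENNReal.ofReal_one]

theorem integral_labelDist (μ₁ μ₂ : Feat D) {σ : ℝ} (p q : ℝ) (hσ : 0 < σ) (f : Feat D)
    (u : Label → ℝ) :
    ∫ k, u k ∂labelDist μ₁ μ₂ σ p q f = ∑ k, classPosterior μ₁ μ₂ σ p q f k * u k := by
  rw [labelDist, integral_finsetSum_measure]
  · refine Finset.sum_congr rfl fun k _ => ?_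
    rw [integral_smul_measure, integral_dirac,
      ENNReal.toReal_ofReal (classPosterior_nonneg _ _ _ _ hσ _ _), smul_eq_mul]
  · intro k _
    exact Integrable.smul_measure (integrable_dirac (by simp)) ENNReal.ofReal_ne_top

theorem integral_labelLaw_eval (μ₁ μ₂ : Feat D) {σ : ℝ} (p q : ℝ) (hσ : 0 < σ)
    (g : Fin n → Feat D) (S : Finset (Fin n)) (i : S) (u : Label → ℝ) :
    ∫ y, u (y i) ∂labelLaw μ₁ μ₂ σ p q g S =
      ∑ k, classPosterior μ₁ μ₂ σ p q (g i) k * u k := by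
  have := fun i : S => isProbabilityMeasure_labelDist μ₁ μ₂ p q hσ (g i)
  rw [← integral_labelDist μ₁ μ₂ p q hσ, labelLaw]
  exact integral_comp_eval (μ := fun i : S => labelDist μ₁ μ₂ σ p q (g i)) (i := i) (f := u)
    (measurable_of_finite u).aestronglyMeasurable

theorem isProbabilityMeasure_labelLaw (μ₁ μ₂ : Feat D) {σ : ℝ} (p q : ℝ) (hσ : 0 < σ)
    (g : Fin n → Feat D) (S : Finset (Fin n)) :
    IsProbabilityMeasure (labelLaw μ₁ μ₂ σ p q g S) := by
  have := fun i : S => isProbabilityMeasure_labelDist μ₁ μ₂ p q hσ (g i)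
  rw [labelLaw]
  infer_instance

theorem expLoss_eq (μ₁ μ₂ : Feat D) {σ : ℝ} (p q : ℝ) (hσ : 0 < σ) (g : Fin n → Feat D)
    (S : Finset (Fin n)) (γ : ℝ) (θ : Params D L w) :
    expLoss μ₁ μ₂ σ p q g S γ θ =
      (S.card : ℝ)⁻¹ * ∑ i ∈ S, nodeLoss μ₁ μ₂ σ p q (g i) γ (logits θ (g i)) := by
  have := isProbabilityMeasure_labelLaw μ₁ μ₂ p q hσ g S
  unfold expLoss empLoss
  rw [integral_const_mul, integral_finsetSum _ fun i _ => .of_finite,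
    ← Finset.sum_coe_sort S]
  congr 1
  refine Finset.sum_congr rfl fun i _ => ?_
  exact integral_labelLaw_eval μ₁ μ₂ p q hσ g S i _

theorem expLoss_mono (μ₁ μ₂ : Feat D) {σ : ℝ} (p q : ℝ) (hσ : 0 < σ) {g : Fin n → Feat D}
    {S : Finset (Fin n)} {γ γ' η : ℝ} {θ θ' : Params D L w}
    (hz : ∀ i ∈ S, ∀ k, |logits θ (g i) k - logits θ' (g i) k| ≤ η) (hγ : γ + 2 * η ≤ γ') :
    expLoss μ₁ μ₂ σ p q g S γ θ ≤ expLoss μ₁ μ₂ σ p q g S γ' θ' := by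
  have := isProbabilityMeasure_labelLaw μ₁ μ₂ p q hσ g S
  exact integral_mono .of_finite .of_finite fun y => empLoss_mono hz hγ y

theorem expLoss_le_one (μ₁ μ₂ : Feat D) {σ : ℝ} (p q : ℝ) (hσ : 0 < σ) (g : Fin n → Feat D)
    (S : Finset (Fin n)) (γ : ℝ) (θ : Params D L w) :
    expLoss μ₁ μ₂ σ p q g S γ θ ≤ 1 := by
  have := isProbabilityMeasure_labelLaw μ₁ μ₂ p q hσ g S
  calc _ ≤ ∫ _, (1 : ℝ) ∂labelLaw μ₁ μ₂ σ p q g S :=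
        integral_mono .of_finite .of_finite fun y => empLoss_le_one g S γ θ y
    _ = 1 := by simp

/-- Each of the two classes costs one difference of posteriors, which explains the factor 2 in
`two_mul_abs_logOdds_sub_le`. -/
theorem nodeLoss_le (μ₁ μ₂ : Feat D) {σ p q p' q' B ε γ γ' η : ℝ} (hσ : 0 < σ) (hp : 0 ≤ p)
    (hq : 0 ≤ q) (hpq : 0 < p + q) (hpq' : 0 < p' + q') {f f' : Feat D} (hf' : ‖f'‖ ≤ B)
    (hε : ‖f - f'‖ ≤ ε) {z z' : Label → ℝ} (hz : ∀ k, |z k - z' k| ≤ η)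
    (hγ : γ + 2 * η ≤ γ') :
    nodeLoss μ₁ μ₂ σ p q f γ z ≤ nodeLoss μ₁ μ₂ σ p' q' f' γ' z' +
      shiftConst μ₁ μ₂ σ B * shiftTerm μ₁ μ₂ σ ε |homophily p' q' - homophily p q| := by
  have h2 := two_mul_abs_logOdds_sub_le μ₁ μ₂ (h' := homophily p' q') hσ
    (homophily_mem_Icc hp hq hpq) hf' hε
  have hk : ∀ k, classPosterior μ₁ μ₂ σ p q f k * marginLoss γ z k ≤
      classPosterior μ₁ μ₂ σ p' q' f' k * marginLoss γ' z' k +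
      |logOdds μ₁ μ₂ σ (homophily p q) f - logOdds μ₁ μ₂ σ (homophily p' q') f'| := by
    intro k
    have h0 := classPosterior_nonneg μ₁ μ₂ p q hσ f k
    have hd := (le_abs_self _).trans (abs_classPosterior_sub_le μ₁ μ₂ hσ hpq hpq' f f' k)
    have hm := marginLoss_le_marginLoss hz hγ k
    have h1 := marginLoss_mem_Icc γ' z' k
    have ha := abs_nonneg
      (logOdds μ₁ μ₂ σ (homophily p q) f - logOdds μ₁ μ₂ σ (homophily p' q') f')
    have h3 := mul_le_mul_of_nonneg_left hm h0
    have h4 := mul_le_mul_of_nonneg_right hd h1.1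
    have h5 := mul_le_mul_of_nonneg_left h1.2 ha
    linarith
  have h6 := hk 0
  have h7 := hk 1
  simp only [nodeLoss, Fin.sum_univ_two]
  linarith

/-! ### Comparison of the test subgroup with the training nodes -/

theorem norm_le_maxNorm (g : Fin n → Feat D) {V₀ V : Finset (Fin n)} {i : Fin n}
    (hi : i ∈ V₀ ∨ i ∈ V) : ‖g i‖ ≤ maxNorm g V₀ V :=
  le_ciSup (f := fun i : {i : Fin n // i ∈ V₀ ∨ i ∈ V} => ‖g i‖)
    (Set.finite_range _).bddAbove ⟨i, hi⟩

theorem exists_mem_nearSet (g : Fin n → Feat D) {V₀ V : Finset (Fin n)} (hV₀ : V₀.Nonempty)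
    {j : Fin n} (hj : j ∈ V) : ∃ i ∈ V₀, j ∈ nearSet g V₀ V i := by
  have : Nonempty V₀ := hV₀.to_subtype
  obtain ⟨i, hi⟩ := exists_eq_ciInf_of_finite (f := fun i : V₀ => ‖g i - g j‖)
  refine ⟨i, i.2, Finset.mem_filter.2 ⟨hj, hi.le.trans ?_⟩⟩
  exact le_ciSup (f := fun j : V => ⨅ i : V₀, ‖g i - g j‖) (Set.finite_range _).bddAbove ⟨j, hj⟩

theorem biUnion_nearSet (g : Fin n → Feat D) {V₀ V : Finset (Fin n)} (hV₀ : V₀.Nonempty) :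
    V₀.biUnion (nearSet g V₀ V) = V := by
  ext j
  rw [Finset.mem_biUnion]
  refine ⟨?_, exists_mem_nearSet g hV₀⟩
  rintro ⟨i, -, hj⟩
  exact (Finset.mem_filter.1 hj).1

theorem featDist_le (g : Fin n → Feat D) {V₀ V : Finset (Fin n)} (hV₀ : V₀.Nonempty) {B : ℝ}
    (hB0 : 0 ≤ B) (hB : maxNorm g V₀ V ≤ B) : featDist g V₀ V ≤ 2 * B := by
  obtain ⟨i, hi⟩ := hV₀
  refine Real.iSup_le (fun j => ?_) (by positivity)
  refine (ciInf_le (Set.finite_range _).bddBelow (⟨i, hi⟩ : V₀)).trans ?_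
  refine (norm_sub_le _ _).trans ?_
  have h1 := norm_le_maxNorm g (V := V) (Or.inl hi)
  have h2 := norm_le_maxNorm g (V₀ := V₀) (Or.inr j.2)
  linarith

/-- The near sets partition `V` into blocks of equal size, so the average over `V` is the average
over `V₀` of block averages, and within a block each node is compared with its training node. -/
theorem expLoss_le_expLoss_of_maxSpec (μ₁ μ₂ : Feat D) {σ p q p₀ q₀ B γ γ' η : ℝ} (hσ : 0 < σ)
    (hp : 0 ≤ p) (hq : 0 ≤ q) (hpq : 0 < p + q) (hpq₀ : 0 < p₀ + q₀) {g : Fin n → Feat D}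
    {V₀ V : Finset (Fin n)} (hV₀ : V₀.Nonempty) (hB : maxNorm g V₀ V ≤ B)
    (hnear : EqualDisjointNearSets g V₀ V) {θ : Params D L w}
    (hθ : maxSpec θ ^ L * featDist g V₀ V ≤ η) (hγ : γ + 2 * η ≤ γ') :
    expLoss μ₁ μ₂ σ p q g V γ θ ≤ expLoss μ₁ μ₂ σ p₀ q₀ g V₀ γ' θ +
      shiftConst μ₁ μ₂ σ B * shiftTerm μ₁ μ₂ σ (featDist g V₀ V)
        |homophily p₀ q₀ - homophily p q| := by
  obtain ⟨hdisj, s, hs, hcard⟩ := hnear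
  set E := shiftConst μ₁ μ₂ σ B * shiftTerm μ₁ μ₂ σ (featDist g V₀ V)
        |homophily p₀ q₀ - homophily p q| with hE
  have hN : (0 : ℝ) < V₀.card := by exact_mod_cast hV₀.card_pos
  have hs' : (0 : ℝ) < s := by exact_mod_cast hs
  have hVcard : V.card = V₀.card * s := by
    conv_lhs => rw [← biUnion_nearSet g (V := V) hV₀]
    rw [Finset.card_biUnion hdisj, Finset.sum_congr rfl hcard, Finset.sum_const, smul_eq_mul]
  have hsum : ∑ j ∈ V, nodeLoss μ₁ μ₂ σ p q (g j) γ (logits θ (g j)) ≤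
      ∑ i ∈ V₀, s * (nodeLoss μ₁ μ₂ σ p₀ q₀ (g i) γ' (logits θ (g i)) + E) := by
    conv_lhs => rw [← biUnion_nearSet g (V := V) hV₀]
    rw [Finset.sum_biUnion hdisj]
    refine Finset.sum_le_sum fun i hi => ?_
    rw [← hcard i hi, ← nsmul_eq_mul]
    refine Finset.sum_le_card_nsmul _ _ _ fun j hj => ?_
    have hij := (Finset.mem_filter.1 hj).2
    rw [norm_sub_rev] at hij
    refine nodeLoss_le μ₁ μ₂ hσ hp hq hpq hpq₀
      ((norm_le_maxNorm g (Or.inl hi)).trans hB) hij (fun k => ?_) hγ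
    refine (abs_logits_sub_le θ _ _ k).trans (le_trans ?_ hθ)
    exact mul_le_mul_of_nonneg_left hij (pow_nonneg (maxSpec_nonneg θ) _)
  rw [expLoss_eq μ₁ μ₂ p q hσ, expLoss_eq μ₁ μ₂ p₀ q₀ hσ, hVcard]
  refine (mul_le_mul_of_nonneg_left hsum (by positivity)).trans (le_of_eq ?_)
  rw [← Finset.mul_sum, Finset.sum_add_distrib, Finset.sum_const, nsmul_eq_mul]
  push_cast
  field_simp

end SubgroupGNN

end

noncomputable section

namespace SubgroupGNN

variable {n D L : ℕ} [NeZero L] {w : ℕ → ℕ}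

/-! ### Uniform deviation of the empirical loss -/

theorem measureReal_expLoss_sub_empLoss_ge_le (μ₁ μ₂ : Feat D) {σ : ℝ} (p q : ℝ) (hσ : 0 < σ)
    (g : Fin n → Feat D) {S : Finset (Fin n)} (hS : S.Nonempty) (γ : ℝ) (θ : Params D L w)
    {t : ℝ} (ht : 0 ≤ t) :
    (labelLaw μ₁ μ₂ σ p q g S).real
      {y | empLoss g S γ θ y + t ≤ expLoss μ₁ μ₂ σ p q g S γ θ} ≤
      Real.exp (-(2 * S.card * t ^ 2)) := by
  have hlaw := isProbabilityMeasure_labelLaw μ₁ μ₂ p q hσ g S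
  have := fun i : S => isProbabilityMeasure_labelDist μ₁ μ₂ p q hσ (g i)
  have hN : (0 : ℝ) < S.card := by exact_mod_cast hS.card_pos
  set ν := labelLaw μ₁ μ₂ σ p q g S with hν
  -- The sign turns the upper tail of the centred sum into expected minus empirical loss. Values in
  -- an interval of length 1 give the variance proxy `1/4`, hence Hoeffding's exponent `2 |S| t²`.
  set u : S → Label → ℝ := fun i k => -marginLoss γ (logits θ (g i)) k with hu
  have hsub : ∀ i ∈ (Finset.univ : Finset S), HasSubgaussianMGF
      (fun y : S → Label => u i (y i) - ∫ y, u i (y i) ∂ν) ((‖(0 : ℝ) - (-1)‖₊ / 2) ^ 2) ν := by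
    intro i _
    refine hasSubgaussianMGF_of_mem_Icc (X := fun y : S → Label => u i (y i))
      (measurable_of_finite _).aemeasurable (ae_of_all _ fun y => ?_)
    have := marginLoss_mem_Icc γ (logits θ (g i)) (y i)
    exact ⟨neg_le_neg this.2, by simpa [hu] using this.1⟩
  have hind : iIndepFun (fun (i : S) (y : S → Label) => u i (y i) - ∫ y, u i (y i) ∂ν) ν :=
    iIndepFun_pi (μ := fun i : S => labelDist μ₁ μ₂ σ p q (g i))
      (X := fun i k => u i k - ∫ y, u i (y i) ∂ν) fun i => (measurable_of_finite _).aemeasurable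
  have h := HasSubgaussianMGF.measure_sum_ge_le_of_iIndepFun hind hsub
    (ε := S.card * t) (by positivity)
  have hset : {y | empLoss g S γ θ y + t ≤ expLoss μ₁ μ₂ σ p q g S γ θ} =
      {y : S → Label | S.card * t ≤ ∑ i : S, (u i (y i) - ∫ y, u i (y i) ∂ν)} := by
    have he : expLoss μ₁ μ₂ σ p q g S γ θ = -((S.card : ℝ)⁻¹ * ∑ i : S, ∫ y, u i (y i) ∂ν) := by
      unfold expLoss empLoss
      rw [integral_const_mul, integral_finsetSum _ fun i _ => .of_finite]
      simp [hu, integral_neg, hν]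
    ext y
    rw [Set.mem_ofPred_eq, Set.mem_ofPred_eq, he, empLoss, Finset.sum_sub_distrib]
    have hneg : ∑ i : S, u i (y i) = -∑ i : S, marginLoss γ (logits θ (g i)) (y i) := by
      simp [hu]
    rw [hneg]
    generalize ∑ i : S, marginLoss γ (logits θ (g i)) (y i) = a
    generalize ∑ i : S, ∫ y, u i (y i) ∂ν = b'
    rw [← mul_le_mul_iff_right₀ hN]
    field_simp
    constructor <;> intro <;> linarith
  rw [hset]
  refine h.trans (Real.exp_le_exp.2 (le_of_eq ?_))
  simp only [Finset.sum_const, Finset.card_univ, Fintype.card_coe]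
  norm_num
  field_simp
  ring

theorem exists_finset_cover (ι : Type*) [Fintype ι] (C : ℝ) {r : ℝ} (hr : 0 < r) :
    ∃ F : Finset (ι → ℝ), (∀ θ ∈ F, ‖θ‖ ≤ C) ∧ ∀ θ, ‖θ‖ ≤ C → ∃ θ' ∈ F, dist θ θ' < r := by
  obtain ⟨t, hts, htf, hcov⟩ := (isCompact_closedBall (0 : ι → ℝ) C).finite_cover_balls hr
  refine ⟨htf.toFinset, fun θ hθ => ?_, fun θ hθ => ?_⟩
  · simpa using hts (htf.mem_toFinset.1 hθ)
  · have := hcov (show θ ∈ Metric.closedBall (0 : ι → ℝ) C by simpa using hθ)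
    simpa using this

theorem ofReal_one_sub_le_labelLaw (μ₁ μ₂ : Feat D) {σ : ℝ} (p q : ℝ) (hσ : 0 < σ)
    (g : Fin n → Feat D) {S : Finset (Fin n)} (hS : S.Nonempty) (γ : ℝ)
    (F : Finset (Params D L w)) {t δ : ℝ} (ht : 0 ≤ t) (hδ : 0 < δ)
    (htδ : Real.log F.card + Real.log (1 / δ) ≤ 2 * S.card * t ^ 2) :
    ENNReal.ofReal (1 - δ) ≤ labelLaw μ₁ μ₂ σ p q g S
      {y | ∀ θ ∈ F, expLoss μ₁ μ₂ σ p q g S γ θ ≤ empLoss g S γ θ y + t} := by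
  have hlaw := isProbabilityMeasure_labelLaw μ₁ μ₂ p q hσ g S
  set ν := labelLaw μ₁ μ₂ σ p q g S with hν
  set bad : Set (S → Label) :=
    ⋃ θ ∈ F, {y | empLoss g S γ θ y + t ≤ expLoss μ₁ μ₂ σ p q g S γ θ} with hbad
  have hsub : badᶜ ⊆ {y | ∀ θ ∈ F, expLoss μ₁ μ₂ σ p q g S γ θ ≤ empLoss g S γ θ y + t} := by
    intro y hy θ hθ
    by_contra hcon
    exact hy (Set.mem_biUnion hθ (not_le.1 hcon).le)
  have hle : ν.real bad ≤ δ := by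
    calc ν.real bad ≤ ∑ θ ∈ F, ν.real
          {y | empLoss g S γ θ y + t ≤ expLoss μ₁ μ₂ σ p q g S γ θ} :=
          measureReal_biUnion_finset_le _ _
      _ ≤ ∑ θ ∈ F, Real.exp (-(2 * S.card * t ^ 2)) := Finset.sum_le_sum fun θ _ =>
          measureReal_expLoss_sub_empLoss_ge_le μ₁ μ₂ p q hσ g hS γ θ ht
      _ = F.card * Real.exp (-(2 * S.card * t ^ 2)) := by simp
      _ ≤ δ := by
        rcases F.card.eq_zero_or_pos with h0 | hpos
        · simpa [h0] using hδ.le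
        · have hF : (0 : ℝ) < F.card := by exact_mod_cast hpos
          calc F.card * Real.exp (-(2 * S.card * t ^ 2))
              ≤ F.card * Real.exp (-(Real.log F.card + Real.log (1 / δ))) := by gcongr
            _ = δ := by
              rw [← Real.log_mul hF.ne' (by positivity), Real.exp_neg,
                Real.exp_log (by positivity)]
              field_simp
  refine le_trans ?_ (measure_mono hsub)
  rw [← ofReal_measureReal, probReal_compl_eq_one_sub (Set.toFinite _).measurableSet]
  exact ENNReal.ofReal_le_ofReal (by linarith)

/-! ### The Gaussian prior -/

/-- The hypothesis `hvr` makes the length `2 * r` of the interval compensate the normalizing factor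
of the density, leaving only the exponential at distance `R`. -/
theorem ofReal_exp_le_gaussianReal_ball {v : ℝ≥0} (hv : v ≠ 0) {a r R : ℝ}
    (hvr : 2 * Real.pi * v ≤ (2 * r) ^ 2) (hr : 0 < r) (hR : |a| + r ≤ R) :
    ENNReal.ofReal (Real.exp (-(R ^ 2 / (2 * v)))) ≤ gaussianReal 0 v (Metric.ball a r) := by
  have hv' : (0 : ℝ) < v := by positivity
  rw [gaussianReal_apply 0 hv]
  have hpdf : ∀ x ∈ Metric.ball a r, ENNReal.ofReal
      ((Real.sqrt (2 * Real.pi * v))⁻¹ * Real.exp (-(R ^ 2 / (2 * v)))) ≤ gaussianPDF 0 v x := by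
    intro x hx
    rw [gaussianPDF, gaussianPDFReal]
    refine ENNReal.ofReal_le_ofReal (mul_le_mul_of_nonneg_left (Real.exp_le_exp.2 ?_)
      (by positivity))
    rw [sub_zero, neg_div, neg_le_neg_iff]
    have hx' : |x| ≤ R := by
      rw [Metric.mem_ball, Real.dist_eq] at hx
      have := abs_sub_abs_le_abs_sub x a
      linarith
    refine div_le_div_of_nonneg_right ?_ (by positivity)
    exact sq_le_sq' (by linarith [neg_abs_le x]) ((le_abs_self x).trans hx')
  calc ENNReal.ofReal (Real.exp (-(R ^ 2 / (2 * v))))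
      ≤ ENNReal.ofReal ((Real.sqrt (2 * Real.pi * v))⁻¹ * Real.exp (-(R ^ 2 / (2 * v)))) *
          volume (Metric.ball a r) := by
        rw [Real.volume_ball, ← ENNReal.ofReal_mul (by positivity)]
        refine ENNReal.ofReal_le_ofReal ?_
        have hs : Real.sqrt (2 * Real.pi * v) ≤ 2 * r := Real.sqrt_le_iff.2 ⟨by positivity, hvr⟩
        have hs0 : 0 < Real.sqrt (2 * Real.pi * v) := by positivity
        have : 1 ≤ (Real.sqrt (2 * Real.pi * v))⁻¹ * (2 * r) := by
          rw [inv_mul_eq_div, one_le_div hs0]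
          exact hs
        nlinarith [Real.exp_pos (-(R ^ 2 / (2 * (v : ℝ))))]
    _ = ∫⁻ _ in Metric.ball a r, ENNReal.ofReal
          ((Real.sqrt (2 * Real.pi * v))⁻¹ * Real.exp (-(R ^ 2 / (2 * v)))) := by
        rw [setLIntegral_const]
    _ ≤ ∫⁻ x in Metric.ball a r, gaussianPDF 0 v x :=
        setLIntegral_mono' Metric.isOpen_ball.measurableSet hpdf

/-- Balls of the sup norm are products of intervals, so the mass factorizes. -/
theorem ofReal_exp_le_pi_gaussianReal_ball {ι : Type*} [Fintype ι] {v : ℝ≥0} (hv : v ≠ 0)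
    {θ : ι → ℝ} {r R : ℝ} (hvr : 2 * Real.pi * v ≤ (2 * r) ^ 2) (hr : 0 < r)
    (hR : ‖θ‖ + r ≤ R) :
    ENNReal.ofReal (Real.exp (-(Fintype.card ι * (R ^ 2 / (2 * v))))) ≤
      Measure.pi (fun _ : ι => gaussianReal 0 v) (Metric.ball θ r) := by
  rw [ball_pi θ hr, Measure.pi_pi]
  calc ENNReal.ofReal (Real.exp (-(Fintype.card ι * (R ^ 2 / (2 * v)))))
      = ∏ _i : ι, ENNReal.ofReal (Real.exp (-(R ^ 2 / (2 * v)))) := by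
        rw [Finset.prod_const, Finset.card_univ, ← ENNReal.ofReal_pow (Real.exp_pos _).le,
          ← Real.exp_nat_mul, mul_neg]
    _ ≤ _ := Finset.prod_le_prod' fun i _ => ofReal_exp_le_gaussianReal_ball hv hvr hr
        (le_trans (by gcongr; exact norm_le_pi_norm θ i) hR)

/-- Conditioning divides by a mass at most 1. A conditional bound thus yields an unconditional one,
with no lower bound on the mass of `s`. -/
theorem measure_inter_le_cond {Ω : Type*} [MeasurableSpace Ω] (μ : Measure Ω)
    [IsProbabilityMeasure μ] (s t : Set Ω) : μ (t ∩ s) ≤ μ[t | s] := by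
  rw [ProbabilityTheory.cond, Measure.smul_apply, smul_eq_mul]
  refine (Measure.le_restrict_apply s t).trans (le_mul_of_one_le_left (zero_le) ?_)
  exact ENNReal.one_le_inv.2 prob_le_one

/-- A Gaussian ball that is heavier than the bound in `ConcentratedLossDiff` contains a
parameter at which the loss difference is small or the spectral norms are. -/
theorem exists_mem_ball_of_concentratedLossDiff {b : ℕ} {μ₁ μ₂ : Feat D} {σ c γ α : ℝ}
    {g : Fin n → Feat D} {V₀ V : Finset (Fin n)} {p₀ q₀ p q : ℝ}
    (hconc : ConcentratedLossDiff L w b μ₁ μ₂ σ c γ α g V₀ V p₀ q₀ p q)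
    {θ : Params D L w} {r : ℝ}
    (hball : ENNReal.ofReal (Real.exp (-(V₀.card : ℝ) ^ (2 * α))) <
      prior D L w (priorVar L b γ (featDist g V₀ V) α V₀.card) (Metric.ball θ r)) :
    ∃ θ' ∈ Metric.ball θ r, maxSpec θ' ^ L * featDist g V₀ V ≤ γ / 8 ∨
      expLoss μ₁ μ₂ σ p q g V (γ / 4) θ' - expLoss μ₁ μ₂ σ p₀ q₀ g V₀ (γ / 2) θ' ≤
        (V₀.card : ℝ) ^ (-α) +
          c * shiftTerm μ₁ μ₂ σ (featDist g V₀ V) |homophily p₀ q₀ - homophily p q| := by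
  by_contra! hcon
  have : IsProbabilityMeasure (prior D L w (priorVar L b γ (featDist g V₀ V) α V₀.card)) := by
    rw [prior]
    infer_instance
  refine absurd hball (not_lt.2 (le_trans ?_ hconc))
  refine le_trans (measure_mono fun θ' hθ' => ?_) (measure_inter_le_cond _ _ _)
  exact ⟨(hcon θ' hθ').2, (hcon θ' hθ').1⟩

end SubgroupGNN

end

/-! ### Estimates for many training nodes: prior mass, norm term, deviation -/

noncomputable section

namespace SubgroupGNN

theorem normTerm_nonneg {D L : ℕ} {w : ℕ → ℕ} {b N : ℕ} {γ α ε : ℝ} (hγ : 0 < γ) (hε : 0 ≤ ε)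
    (θ : Params D L w) :
    0 ≤ normTerm b γ α ε N θ := by
  have hsum0 : 0 ≤ ∑ l : Fin L, frobSq (weight θ l) :=
    Finset.sum_nonneg fun _ _ => frobSq_nonneg _
  rw [normTerm]
  positivity

variable {n D L : ℕ} [NeZero L] {w : ℕ → ℕ}

/-- With `u = N^α`, the negative logarithm of the mass is at most linear in `u`, while the target is
`u²`. The bound `ε₀ ≤ ε` keeps the variance small and `ε ≤ E` keeps it from being too small. -/
theorem exists_forall_lt_prior_ball (D L : ℕ) [NeZero L] (w : ℕ → ℕ) {b : ℕ} (hb : 1 ≤ b)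
    {γ C ε₀ r E : ℝ} (hγ : 0 < γ) (hC : 0 ≤ C) (hε₀ : 0 < ε₀) (hr : 0 < r) (hr1 : r ≤ 1) :
    ∃ u₀ : ℝ, ∀ (N : ℕ) (α ε : ℝ), 0 < N → u₀ ≤ (N : ℝ) ^ α → ε₀ ≤ ε → ε ≤ E →
      ∀ θ : Params D L w, ‖θ‖ ≤ C →
        ENNReal.ofReal (Real.exp (-(N : ℝ) ^ (2 * α))) <
          prior D L w (priorVar L b γ ε α N) (Metric.ball θ r) := by
  have hb' : (1 : ℝ) ≤ b := by exact_mod_cast hb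
  have hL : (1 : ℝ) ≤ L := by exact_mod_cast NeZero.one_le
  have hlog : 0 ≤ Real.log (2 * b * L) := Real.log_nonneg (by nlinarith)
  set d := Fintype.card (Σ l : Fin L, Fin (width D L w (l + 1)) × Fin (width D L w l)) with hd
  set K := (d : ℝ) * ((C + 1) ^ 2 * b / (γ / (8 * E)) ^ (2 / (L : ℝ))) with hK
  set a := (γ / (8 * ε₀)) ^ (2 / (L : ℝ)) with ha
  -- The first two thresholds give `K (u + ln (2bL)) ≤ K (1 + ln (2bL)) u < u²`; the third gives
  -- `2πv ≤ (2r)²`.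
  refine ⟨max 1 (max (K * (1 + Real.log (2 * b * L)) + 1) (Real.pi * a / (4 * r ^ 2))),
    fun N α ε hN hu hε hεE θ hθ => ?_⟩
  have hN' : (0 : ℝ) < N := by exact_mod_cast hN
  set u := (N : ℝ) ^ α with hudef
  have hu1 : 1 ≤ u := (le_max_left _ _).trans hu
  have hu2 : K * (1 + Real.log (2 * b * L)) + 1 ≤ u :=
    (le_max_left _ _).trans ((le_max_right _ _).trans hu)
  have hu3 : Real.pi * a / (4 * r ^ 2) ≤ u :=
    (le_max_right _ _).trans ((le_max_right _ _).trans hu)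
  have hε' : 0 < ε := hε₀.trans_le hε
  have hE : 0 < E := hε'.trans_le hεE
  have hu0 : 0 < u := by positivity
  have hN2 : (N : ℝ) ^ (2 * α) = u ^ 2 := by
    rw [hudef, ← Real.rpow_natCast, ← Real.rpow_mul hN'.le, mul_comm]
    norm_num
  have hv : priorVar L b γ ε α N =
      (γ / (8 * ε)) ^ (2 / (L : ℝ)) / (2 * b * (u + Real.log (2 * b * L))) := by
    rw [priorVar, ← Real.rpow_add hN', hudef]
    congr 4
    ring_nf
  have hpow : 0 < (γ / (8 * ε)) ^ (2 / (L : ℝ)) := by positivity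
  have hpow₁ : (γ / (8 * ε)) ^ (2 / (L : ℝ)) ≤ a := by
    rw [ha]
    gcongr
  have hpow₂ : (γ / (8 * E)) ^ (2 / (L : ℝ)) ≤ (γ / (8 * ε)) ^ (2 / (L : ℝ)) := by
    gcongr
  have hpowE : 0 < (γ / (8 * E)) ^ (2 / (L : ℝ)) := by positivity
  set v := priorVar L b γ ε α N with hvdef
  have hv0 : 0 < v := by rw [hv]; positivity
  have hcoe : ((v.toNNReal : ℝ≥0) : ℝ) = v := Real.coe_toNNReal _ hv0.le
  have hva : v ≤ a / (2 * u) := by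
    rw [hv]
    have h1 : 2 * u ≤ 2 * b * (u + Real.log (2 * b * L)) := by
      have : 1 * u ≤ b * (u + Real.log (2 * b * L)) :=
        mul_le_mul hb' (by linarith) hu0.le (by positivity)
      linarith
    gcongr
  have hvr : 2 * Real.pi * (v.toNNReal : ℝ≥0) ≤ (2 * r) ^ 2 := by
    rw [hcoe]
    rw [div_le_iff₀ (by positivity)] at hu3
    rw [le_div_iff₀ (by positivity)] at hva
    have := mul_le_mul_of_nonneg_left hva Real.pi_pos.le
    refine le_of_mul_le_mul_right ?_ hu0
    linarith
  refine lt_of_lt_of_le ?_ (ofReal_exp_le_pi_gaussianReal_ball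
    (by simpa using hv0) hvr hr (R := C + 1) (by linarith))
  refine (ENNReal.ofReal_lt_ofReal_iff (Real.exp_pos _)).2 (Real.exp_lt_exp.2 ?_)
  rw [neg_lt_neg_iff, hcoe, hN2, ← hd]
  have hlow : (d : ℝ) * ((C + 1) ^ 2 / (2 * v)) ≤ K * (u + Real.log (2 * b * L)) := by
    have h1 : (C + 1) ^ 2 / (2 * v) = (C + 1) ^ 2 * b / (γ / (8 * ε)) ^ (2 / (L : ℝ)) *
        (u + Real.log (2 * b * L)) := by
      rw [hv]
      field_simp
    rw [h1, hK, ← mul_assoc]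
    gcongr
  have hK0 : 0 ≤ K := by rw [hK]; positivity
  have h2 : K * Real.log (2 * b * L) * 1 ≤ K * Real.log (2 * b * L) * u :=
    mul_le_mul_of_nonneg_left hu1 (by positivity)
  have h3 := mul_le_mul_of_nonneg_right hu2 hu0.le
  nlinarith

/-- The exponent `2 / L` turns `T_h^L` into `T_h²`, which is at most the sum of the squared
Frobenius norms. -/
theorem mul_rpow_neg_le_normTerm {b N : ℕ} (hb : 1 ≤ b) (hN : 0 < N) {γ α ε a : ℝ} (hγ : 0 < γ)
    (hε : 0 ≤ ε) (ha : 0 ≤ a) {θ : Params D L w} (hθ : a ≤ maxSpec θ ^ L) :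
    (8 * a * ε / γ) ^ (2 / (L : ℝ)) * (N : ℝ) ^ (-α) ≤ normTerm b γ α ε N θ := by
  have hb' : (1 : ℝ) ≤ b := by exact_mod_cast hb
  have hN' : (0 : ℝ) < N := by exact_mod_cast hN
  have hL : (L : ℝ) ≠ 0 := by exact_mod_cast NeZero.ne L
  have hsum0 : 0 ≤ ∑ l : Fin L, frobSq (weight θ l) :=
    Finset.sum_nonneg fun _ _ => frobSq_nonneg _
  have hpow : a ^ (2 / (L : ℝ)) ≤ b * ∑ l : Fin L, frobSq (weight θ l) := by
    calc a ^ (2 / (L : ℝ)) ≤ (maxSpec θ ^ L) ^ (2 / (L : ℝ)) := by gcongr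
      _ = maxSpec θ ^ 2 := by
        rw [← Real.rpow_natCast, ← Real.rpow_mul (maxSpec_nonneg θ), mul_div_cancel₀ _ hL]
        norm_num
      _ ≤ ∑ l : Fin L, frobSq (weight θ l) :=
        (Real.le_sqrt (maxSpec_nonneg θ) hsum0).1 (maxSpec_le_sqrt_sum_frobSq θ)
      _ ≤ _ := le_mul_of_one_le_left hsum0 hb'
  have hsplit : (8 * a * ε / γ) ^ (2 / (L : ℝ)) * (N : ℝ) ^ (-α) =
      a ^ (2 / (L : ℝ)) / ((γ / 8) ^ (2 / (L : ℝ)) * (N : ℝ) ^ α) * ε ^ (2 / (L : ℝ)) := by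
    rw [show 8 * a * ε / γ = a * ε / (γ / 8) by field_simp,
      Real.div_rpow (by positivity) (by positivity), Real.mul_rpow ha hε, Real.rpow_neg hN'.le]
    field_simp
  rw [hsplit, normTerm]
  gcongr

theorem shiftTerm_nonneg (μ₁ μ₂ : Feat D) {σ ε Δ : ℝ} (hσ : 0 < σ) (hε : 0 ≤ ε) (hΔ : 0 ≤ Δ) :
    0 ≤ shiftTerm μ₁ μ₂ σ ε Δ := by
  rw [shiftTerm]
  positivity

theorem log_one_div_le_remainder (L : ℕ) (γ α C B : ℝ) {δ : ℝ} (hδ : 0 < δ) (N : ℕ) :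
    1 / (N : ℝ) ^ (1 - 2 * α) + 1 / (N : ℝ) ^ (2 * α) * Real.log (1 / δ) ≤
      remainder L γ α C B δ N := by
  rw [remainder]
  gcongr
  exact le_max_left _ _

/-- Either every training margin is at most `γ`, or the weights are large. -/
theorem empLoss_eq_one_or_le_maxSpec_pow {g : Fin n → Feat D} {S : Finset (Fin n)}
    (hS : S.Nonempty) {B : ℝ} (hB : ∀ i ∈ S, ‖g i‖ ≤ B) (hB0 : 0 < B) {γ : ℝ}
    (θ : Params D L w) (y : S → Label) :
    empLoss g S γ θ y = 1 ∨ γ / (2 * B) ≤ maxSpec θ ^ L := by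
  by_cases h : ∀ i : S, marginLoss γ (logits θ (g i)) (y i) = 1
  · left
    have hN : (S.card : ℝ) ≠ 0 := by exact_mod_cast hS.card_pos.ne'
    simp [empLoss, h, hN]
  · right
    push Not at h
    obtain ⟨i, hi⟩ := h
    rw [marginLoss, iSup_ne_label] at hi
    have hlt : γ + logits θ (g i) (1 - y i) < logits θ (g i) (y i) := by
      by_contra hcon
      exact hi (if_pos (not_lt.1 hcon))
    have h1 := abs_le.1 (abs_logits_le θ (g i) (y i))
    have h2 := abs_le.1 (abs_logits_le θ (g i) (1 - y i))
    have h3 := mul_le_mul_of_nonneg_left (hB i i.2) (pow_nonneg (maxSpec_nonneg θ) L)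
    rw [div_le_iff₀ (by positivity)]
    linarith [h1.2, h2.1]

/-- The deviation term is large enough for the union bound. -/
theorem log_add_log_le_deviation {N : ℕ} (hN : 0 < N) {α δ τ Λ : ℝ} (hα : α < 1 / 4)
    (hδ : 0 < δ) (hδ1 : δ < 1) (hτ : 0 < τ)
    (hΛ : Λ / (2 * τ ^ 2) ≤ (N : ℝ) ^ α) :
    Λ + Real.log (1 / δ) ≤ 2 * N * ((1 / (N : ℝ) ^ (1 - 2 * α) +
      1 / (N : ℝ) ^ (2 * α) * Real.log (1 / δ)) + τ * (N : ℝ) ^ (-α)) ^ 2 := by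
  have hN' : (0 : ℝ) < N := by exact_mod_cast hN
  have hN1' : (1 : ℝ) ≤ N := by exact_mod_cast hN
  have hl : 0 ≤ Real.log (1 / δ) := Real.log_nonneg (by rw [le_div_iff₀ hδ]; linarith)
  have hxy : (N : ℝ) * (1 / (N : ℝ) ^ (1 - 2 * α)) * (1 / (N : ℝ) ^ (2 * α)) = 1 := by
    have : (N : ℝ) ^ (1 - 2 * α) * (N : ℝ) ^ (2 * α) = N := by
      rw [← Real.rpow_add hN']
      simp
    field_simp
    linarith
  have hτN : Λ ≤ 2 * (τ ^ 2 * (N * ((N : ℝ) ^ (-α)) ^ 2)) := by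
    have h1 : (N : ℝ) * ((N : ℝ) ^ (-α)) ^ 2 = (N : ℝ) ^ (1 - 2 * α) := by
      rw [← Real.rpow_natCast, ← Real.rpow_mul hN'.le]
      nth_rw 1 [← Real.rpow_one (N : ℝ)]
      rw [← Real.rpow_add hN']
      congr 1
      push_cast
      ring
    -- `α < 1/4` is more than enough for `α ≤ 1 - 2α`.
    have h2 : (N : ℝ) ^ α ≤ (N : ℝ) ^ (1 - 2 * α) :=
      Real.rpow_le_rpow_of_exponent_le hN1' (by linarith)
    rw [div_le_iff₀ (by positivity)] at hΛ
    rw [h1]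
    have := mul_le_mul_of_nonneg_left h2 (sq_nonneg τ)
    linarith
  have hx : 0 ≤ 1 / (N : ℝ) ^ (1 - 2 * α) := by positivity
  have hy : 0 ≤ 1 / (N : ℝ) ^ (2 * α) * Real.log (1 / δ) := by positivity
  have hz : 0 ≤ τ * (N : ℝ) ^ (-α) := by positivity
  have hxyl : N * ((1 / (N : ℝ) ^ (1 - 2 * α)) * (1 / (N : ℝ) ^ (2 * α) * Real.log (1 / δ))) =
      Real.log (1 / δ) := by
    rw [← mul_assoc, ← mul_assoc, hxy, one_mul]
  generalize 1 / (N : ℝ) ^ (2 * α) * Real.log (1 / δ) = y at *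
  generalize 1 / (N : ℝ) ^ (1 - 2 * α) = x at *
  -- Since `N x y = ln (1/δ)`, the cross term alone pays for the confidence, and the square of `τ
  -- N^{-α}` pays for `Λ`; the rest is nonnegative.
  have hexp : 2 * (N : ℝ) * (x + y + τ * (N : ℝ) ^ (-α)) ^ 2 =
      4 * (N * (x * y)) + 2 * (τ ^ 2 * (N * ((N : ℝ) ^ (-α)) ^ 2)) +
      2 * N * (x ^ 2 + y ^ 2 + 2 * (x + y) * (τ * (N : ℝ) ^ (-α))) := by ring
  have hrest : 0 ≤ 2 * N * (x ^ 2 + y ^ 2 + 2 * (x + y) * (τ * (N : ℝ) ^ (-α))) := by positivity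
  rw [hexp, hxyl]
  linarith

end SubgroupGNN

end

/-! ### The subgroup generalization bound -/

open SubgroupGNN in
/-- The constant `A` depends only on the class means, `σ`, the bound `B` on the aggregated features
and the constant `c`. "Large enough" for the number of training nodes depends in addition on the
architecture, `γ`, `C`, `α` and a lower bound `ε₀` of the feature distance. -/
theorem theorem1 (D : ℕ) (μ₁ μ₂ : Feat D) (σ : ℝ) (hσ : 0 < σ) (B : ℝ) (c : ℝ) (hc : 0 ≤ c) :
    ∃ A : ℝ, 0 < A ∧
      ∀ (L : ℕ) [NeZero L] (w : ℕ → ℕ) (b : ℕ), 1 ≤ b → (∀ l, 0 < l → l < L → w l ≤ b) →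
      ∀ γ C α ε₀ : ℝ, 0 < γ → 0 < C → 0 < α → α < 1 / 4 → 0 < ε₀ →
      ∃ N₁ : ℕ, ∀ (n : ℕ) (G : SimpleGraph (Fin n)) (X : Fin n → Feat D)
        (M : ℕ) (V : Fin (M + 1) → Finset (Fin n)) (p q : Fin (M + 1) → ℝ),
        IsGeneralizedCSBMS p q →
        ∀ m : Fin (M + 1), m ≠ 0 →
        N₁ ≤ (V 0).card →
        maxNorm (aggregate G X) (V 0) (V m) ≤ B →
        ε₀ ≤ featDist (aggregate G X) (V 0) (V m) →
        EqualDisjointNearSets (aggregate G X) (V 0) (V m) →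
        ConcentratedLossDiff L w b μ₁ μ₂ σ c γ α (aggregate G X) (V 0) (V m)
          (p 0) (q 0) (p m) (q m) →
        ∀ δ : ℝ, 0 < δ → δ < 1 →
          ENNReal.ofReal (1 - δ) ≤
            labelLaw μ₁ μ₂ σ (p 0) (q 0) (aggregate G X) (V 0)
              {y | ∀ θ : Params D L w, (∀ l, Real.sqrt (frobSq (weight θ l)) ≤ C) →
                expLoss μ₁ μ₂ σ (p m) (q m) (aggregate G X) (V m) 0 θ ≤
                  empLoss (aggregate G X) (V 0) γ θ y +
                    A * (shiftTerm μ₁ μ₂ σ (featDist (aggregate G X) (V 0) (V m))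
                          |homophily (p 0) (q 0) - homophily (p m) (q m)| +
                        normTerm b γ α (featDist (aggregate G X) (V 0) (V m)) (V 0).card θ +
                        remainder L γ α C (maxNorm (aggregate G X) (V 0) (V m)) δ
                          (V 0).card)} := by
  have hA₁ := shiftConst_nonneg μ₁ μ₂ hσ B
  set A₁ := shiftConst μ₁ μ₂ σ B with hA₁def
  -- The shift is paid with `c` or `A₁` according to the case; the 2 covers the two uses of the norm
  -- term, for `τ N^{-α}` and for `N^{-α}`.
  refine ⟨max c A₁ + 2, by have := hA₁.trans (le_max_right c A₁); linarith, ?_⟩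
  intro L _ w b hb _ γ C α ε₀ hγ hC hα hα' hε₀
  -- With `η = γ/16`, moving the parameters by less than `r` costs `γ/8` of margin. The margins used
  -- are `0` and `γ/4` on the test nodes, then `γ/2`, `5γ/8`, `3γ/4` (at the net point) and `γ` on
  -- the training nodes.
  obtain ⟨r, hr, hr1, hcont⟩ :=
    exists_forall_abs_logits_sub_le D L w (C + 1) B (η := γ / 16) (by positivity)
  obtain ⟨F, hFC, hF⟩ := exists_finset_cover
    (Σ l : Fin L, Fin (width D L w (l + 1)) × Fin (width D L w l)) C hr
  obtain ⟨u₀, hu₀⟩ := exists_forall_lt_prior_ball D L w (E := 2 * B) hb hγ hC.le hε₀ hr hr1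
  -- This is the factor that `mul_rpow_neg_le_normTerm` gives for `a = γ/(2B)`, with `ε` replaced by
  -- its lower bound `ε₀`.
  set τ := (4 * ε₀ / B) ^ (2 / (L : ℝ)) with hτdef
  have hlarge : ∀ᶠ N : ℕ in Filter.atTop,
      max u₀ (Real.log F.card / (2 * τ ^ 2)) ≤ (N : ℝ) ^ α :=
    ((tendsto_rpow_atTop hα).comp tendsto_natCast_atTop_atTop).eventually_ge_atTop _
  obtain ⟨N₁, hN₁⟩ := Filter.eventually_atTop.1 (hlarge.and (Filter.eventually_gt_atTop 0))
  refine ⟨N₁, fun n G X M V p q hpq m _ hN hB hε hnear hconc δ hδ hδ1 => ?_⟩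
  obtain ⟨hu, hNpos⟩ := hN₁ _ hN
  have hu1 := (le_max_left _ _).trans hu
  have hu2 := (le_max_right _ _).trans hu
  set g := aggregate G X with hg
  set N := (V 0).card with hNdef
  set ε := featDist g (V 0) (V m) with hεdef
  set Sh := shiftTerm μ₁ μ₂ σ ε |homophily (p 0) (q 0) - homophily (p m) (q m)| with hSh
  have hV₀ : (V 0).Nonempty := Finset.card_pos.1 hNpos
  have hε0 : 0 < ε := hε₀.trans_le hε
  have hBmax0 : 0 ≤ maxNorm g (V 0) (V m) := Real.iSup_nonneg fun _ => norm_nonneg _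
  have hε2B : ε ≤ 2 * B := featDist_le g hV₀ (hBmax0.trans hB) hB
  have hB0 : 0 < B := by linarith
  have hτ : 0 < τ := by rw [hτdef]; positivity
  have hSh0 : 0 ≤ Sh := shiftTerm_nonneg μ₁ μ₂ hσ hε0.le (abs_nonneg _)
  have hgB : ∀ i, i ∈ V 0 ∨ i ∈ V m → ‖g i‖ ≤ B := fun i hi => (norm_le_maxNorm g hi).trans hB
  have hNα : 0 ≤ (N : ℝ) ^ (-α) := by positivity
  set x := 1 / (N : ℝ) ^ (1 - 2 * α) + 1 / (N : ℝ) ^ (2 * α) * Real.log (1 / δ) with hx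
  have hx0 : 0 ≤ x := by
    have : 0 ≤ Real.log (1 / δ) := Real.log_nonneg (by rw [le_div_iff₀ hδ]; linarith)
    positivity
  have hxR : x ≤ remainder L γ α C (maxNorm g (V 0) (V m)) δ N :=
    log_one_div_le_remainder L γ α C _ hδ N
  set R := remainder L γ α C (maxNorm g (V 0) (V m)) δ N with hR
  refine (ofReal_one_sub_le_labelLaw μ₁ μ₂ (p 0) (q 0) hσ g hV₀ (3 * γ / 4) F
    (t := x + τ * (N : ℝ) ^ (-α)) (by positivity) hδ
    (log_add_log_le_deviation hNpos hα' hδ hδ1 hτ hu2)).trans (measure_mono ?_)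
  intro y hy θ hθ
  have hθC : ‖θ‖ ≤ C := norm_le_of_sqrt_frobSq_le hC.le θ hθ
  have hT0 : 0 ≤ normTerm b γ α ε N θ := normTerm_nonneg hγ hε0.le θ
  set T := normTerm b γ α ε N θ with hT
  have hcA := le_max_left c A₁
  have hAA := le_max_right c A₁
  set A := max c A₁ with hA
  have hcSh := mul_le_mul_of_nonneg_right hcA hSh0
  have hASh := mul_le_mul_of_nonneg_right hAA hSh0
  have hAT : 0 ≤ A * (T + R) := mul_nonneg (hA₁.trans hAA) (by linarith)
  have hexpand : (A + 2) * (Sh + T + R) = A * Sh + A * (T + R) + 2 * (Sh + T + R) := by ring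
  rw [hexpand]
  have hASh0 := mul_nonneg (hA₁.trans hAA) hSh0
  rcases empLoss_eq_one_or_le_maxSpec_pow hV₀ (fun i hi => hgB i (Or.inl hi)) hB0 (γ := γ) θ y
    with h1 | hbig
  · rw [h1]
    have := expLoss_le_one μ₁ μ₂ (p m) (q m) hσ g (V m) 0 θ
    linarith
  have hτT : τ * (N : ℝ) ^ (-α) ≤ T := by
    refine le_trans ?_ (mul_rpow_neg_le_normTerm hb hNpos hγ hε0.le (by positivity) hbig)
    refine mul_le_mul_of_nonneg_right ?_ hNα
    rw [hτdef]
    refine Real.rpow_le_rpow (by positivity) ?_ (by positivity)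
    rw [show 8 * (γ / (2 * B)) * ε / γ = 4 * ε / B by field_simp; norm_num]
    gcongr
  have hdev : expLoss μ₁ μ₂ σ (p 0) (q 0) g (V 0) (5 * γ / 8) θ ≤
      empLoss g (V 0) γ θ y + (x + τ * (N : ℝ) ^ (-α)) := by
    obtain ⟨θ', hθ', hdist⟩ := hF θ hθC
    have hclose := hcont θ θ' (by linarith) (by linarith [hFC θ' hθ']) hdist
    refine (expLoss_mono μ₁ μ₂ (p 0) (q 0) hσ (θ' := θ') (γ' := 3 * γ / 4) (η := γ / 16)
      (fun i hi k => hclose _ (hgB i (Or.inl hi)) k) (by linarith)).trans ?_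
    refine (hy θ' hθ').trans (add_le_add_left (empLoss_mono (η := γ / 16)
      (fun i hi k => ?_) (by linarith) y) _)
    rw [abs_sub_comm]
    exact hclose _ (hgB i (Or.inl hi)) k
  have hnet : ∀ θ' : Params D L w, maxSpec θ' ^ L * ε ≤ γ / 8 →
      expLoss μ₁ μ₂ σ (p m) (q m) g (V m) (γ / 4) θ' ≤
        expLoss μ₁ μ₂ σ (p 0) (q 0) g (V 0) (γ / 2) θ' + A₁ * Sh := fun θ' h =>
    expLoss_le_expLoss_of_maxSpec μ₁ μ₂ hσ (hpq.p_mem m).1 (hpq.q_mem m).1 (hpq.pos m)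
      (hpq.pos 0) hV₀ hB hnear h (by linarith)
  rcases le_or_gt (maxSpec θ ^ L * ε) (γ / 8) with hsmall | hlargeSpec
  · have h1 := hnet θ hsmall
    have h2 := expLoss_mono μ₁ μ₂ (p m) (q m) hσ (g := g) (S := V m) (γ := 0) (γ' := γ / 4)
      (η := 0) (θ := θ) (θ' := θ) (by simp) (by linarith)
    have h3 := expLoss_mono μ₁ μ₂ (p 0) (q 0) hσ (g := g) (S := V 0) (γ := γ / 2)
      (γ' := 5 * γ / 8) (η := 0) (θ := θ) (θ' := θ) (by simp) (by linarith)
    linarith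
  -- The choice `a = γ/(8ε)` makes the base of the power equal to 1.
  · have hNT : (N : ℝ) ^ (-α) ≤ T := by
      have h := mul_rpow_neg_le_normTerm (α := α) (θ := θ) (a := γ / (8 * ε)) hb hNpos hγ hε0.le
        (by positivity) (by rw [div_le_iff₀ (by positivity)]; linarith)
      rwa [show 8 * (γ / (8 * ε)) * ε / γ = 1 by field_simp, Real.one_rpow, one_mul] at h
    obtain ⟨θ', hθ', hgood⟩ := exists_mem_ball_of_concentratedLossDiff hconc
      (hu₀ N α ε hNpos hu1 hε hε2B θ hθC)
    rw [Metric.mem_ball] at hθ'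
    have hθ'C : ‖θ'‖ ≤ C + 1 := by
      have := norm_le_norm_add_norm_sub' θ' θ
      rw [dist_eq_norm] at hθ'
      linarith
    have hclose := hcont θ' θ hθ'C (by linarith) hθ'
    have h1 : expLoss μ₁ μ₂ σ (p m) (q m) g (V m) 0 θ ≤
        expLoss μ₁ μ₂ σ (p m) (q m) g (V m) (γ / 4) θ' :=
      expLoss_mono μ₁ μ₂ (p m) (q m) hσ (η := γ / 16) (fun i hi k => by
        rw [abs_sub_comm]
        exact hclose _ (hgB i (Or.inr hi)) k) (by linarith)
    have h2 : expLoss μ₁ μ₂ σ (p 0) (q 0) g (V 0) (γ / 2) θ' ≤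
        expLoss μ₁ μ₂ σ (p 0) (q 0) g (V 0) (5 * γ / 8) θ :=
      expLoss_mono μ₁ μ₂ (p 0) (q 0) hσ (η := γ / 16)
        (fun i hi k => hclose _ (hgB i (Or.inl hi)) k) (by linarith)
    have h3 : expLoss μ₁ μ₂ σ (p m) (q m) g (V m) (γ / 4) θ' ≤
        expLoss μ₁ μ₂ σ (p 0) (q 0) g (V 0) (γ / 2) θ' + (N : ℝ) ^ (-α) + A * Sh := by
      -- The point of the ball may have small spectral norms even though the centre does not; the
      -- deterministic comparison then applies to it.
      rcases hgood with h | h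
      · linarith [hnet θ' h]
      · linarith
    linarith
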